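/- Let $E$ be a nonzero real Banach space with dual $E^*$ and bidual $E^{**}$, and let $\widehat{x}\in E^{**}$ be the canonical image of $x\in E$; write $\widehat E=\{\widehat x : x\in E\}$. For $f\colon E\times E^*\to{]}{-\infty},\infty]$ put $\operatorname{dom} f=\{f<\infty\}$, let $f^*\colon E^*\times E^{**}\to[-\infty,\infty]$ be the Fenchel conjugate $$f^*(x^*,x^{**})=\sup_{(y,y^*)\in E\times E^*}\bigl[\langle y,x^*\rangle+\langle y^*,x^{**}\rangle-f(y,y^*)\bigr],$$ and let $\mathcal M f\colon E\rightrightarrows E^*$ be the multifunction $(\mathcal M f)x=\{x^*: f(x,x^*)=\langle x,x^*\rangle\}$; similarly $\mathcal M f^*\colon E^*\rightrightarrows E^{**}$, $(\mathcal M f^*)x^*=\{x^{**}: f^*(x^*,x^{**})=\langle x^*,x^{**}\rangle\}$. Call $f$ strongly representative if it is proper, convex and (norm) lower semicontinuous, $f(x,x^*)\ge\langle x,x^*\rangle$ for all $(x,x^*)\in E\times E^*$, and $f^*(x^*,x^{**})\ge\langle x^*,x^{**}\rangle$ for all $(x^*,x^{**})\in E^*\times E^{**}$. Call a multifunction $S\colon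 E\rightrightarrows E^*$ strongly representable if $S=\mathcal M f$ for some strongly representative $f$. For multifunctions, $(S+T)x=Sx+Tx$, $S^{-1}y=\{x: y\in Sx\}$, $\mathcal R(S)=\bigcup_x Sx$, and the parallel sum is $(S\parallel T)x=\{x^*: \text{there is } v\in E \text{ with } x^*\in S(x-v)\cap Tv\}$. Let $\pi_E(x,x^*)=x$ and $\pi_{E^*}(x,x^*)=x^*$. Let $f$ and $g$ be strongly representative functions on $E\times E^*$. (a) If $\bigcup_{\lambda>0}\lambda\,[\pi_E\operatorname{dom} g-\pi_E\operatorname{dom} f]$ is a closed subspace of $E$, then $\mathcal M f+\mathcal M g$ is strongly representable. (b) If $\bigcup_{\lambda>0}\lambda\,[\pi_{E^*}\operatorname{dom} g-\pi_{E^*}\operatorname{dom} f]$ is a closed subspace of $E^*$, then the multifunction $x\mapsto(\mathcal M f^*+\mathcal M g^*)^{-1}\widehat x$ from $E$ to $E^*$ is strongly representable. (c) If $\bigcup_{\lambda>0}\lambda\,[\pi_{E^*}\operatorname{dom} g-\pi_{E^*}\operatorname{dom} f]$ is a closed subspace of $E^*$ and $\mathcal R(\mathcal M g^*)\subset\widehat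 E$, then $\mathcal M f\parallel\mathcal M g$ is strongly representable. -/

import Mathlib

open scoped Pointwise

noncomputable section

namespace StrongRep

section Convex

variable {X : Type*} [NormedAddCommGroup X] [NormedSpace ℝ X]

/-- `IsPCLSC h`: the extended-real function `h` on the normed space `X` never takes the value
`-∞`, is not identically `+∞`, is convex, and is lower semicontinuous for the norm topology. -/
structure IsPCLSC (h : X → EReal) : Prop where
  ne_bot : ∀ x, h x ≠ ⊥
  proper : ∃ x, h x ≠ ⊤
  convex : ∀ x y : X, ∀ a b : ℝ, 0 < a → 0 < b → a + b = 1 →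
    h (a • x + b • y) ≤ (a : EReal) * h x + (b : EReal) * h y
  lsc : LowerSemicontinuous h

/-- The effective domain of an extended-real function. -/
def dom (h : X → EReal) : Set X := {x | h x < ⊤}

/-- The cone `⋃_{t > 0} t • [C - D]` generated by the difference set of `C` and `D`. -/
def coneDiff (C D : Set X) : Set X := ⋃ t ∈ Set.Ioi (0 : ℝ), t • (C - D)

/-- The set `A` is (the underlying set of) a closed linear subspace. -/
def IsClosedSubspace (A : Set X) : Prop := ∃ L : Submodule ℝ X, (L : Set X) = A ∧ IsClosed A

end Convex

section Conjugate

variable {X Y : Type*} [NormedAddCommGroup X] [NormedSpace ℝ X]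
  [NormedAddCommGroup Y] [NormedSpace ℝ Y]

/-- The Fenchel conjugate of a function on `X × Y`. The dual of `X × Y` is identified with
`X* × Y*` through `⟨(x, y), (x*, y*)⟩ = ⟨x, x*⟩ + ⟨y, y*⟩`. With `X = E` and `Y = E*` this is
a function on `E* × E**`. -/
def conj (f : X × Y → EReal) : StrongDual ℝ X × StrongDual ℝ Y → EReal :=
  fun p => ⨆ z : X × Y, ((p.1 z.1 + p.2 z.2 : ℝ) : EReal) - f z

end Conjugate

section Multifunction

/-- Multifunctions from `X` to `Y`; the sum of two of them is the pointwise Minkowski sum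
`(S + T) x = S x + T x`. -/
abbrev Multi (X Y : Type*) := X → Set Y

/-- The inverse multifunction. -/
def Multi.inverse {X Y : Type*} (S : Multi X Y) : Multi Y X := fun y => {x | y ∈ S x}

/-- The range of a multifunction. -/
def Multi.range {X Y : Type*} (S : Multi X Y) : Set Y := ⋃ x, S x

/-- The parallel sum: `y ∈ (S ∥ T) x` iff there is `v` with `y ∈ S (x - v) ∩ T v`. -/
def Multi.parallelSum {X Y : Type*} [Sub X] (S T : Multi X Y) : Multi X Y :=
  fun x => {y | ∃ v : X, y ∈ S (x - v) ∩ T v}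

end Multifunction

section Representative

variable {E : Type*} [NormedAddCommGroup E] [NormedSpace ℝ E]

/-- Representative functions on `E × E*`. -/
structure IsRepresentative (f : E × StrongDual ℝ E → EReal) : Prop where
  pclsc : IsPCLSC f
  ge_pairing : ∀ (x : E) (x' : StrongDual ℝ E), ((x' x : ℝ) : EReal) ≤ f (x, x')

/-- Strongly representative functions on `E × E*`. -/
structure IsStronglyRepresentative (f : E × StrongDual ℝ E → EReal) : Prop where
  representative : IsRepresentative f
  conj_ge_pairing : ∀ (x' : StrongDual ℝ E) (x'' : StrongDual ℝ (StrongDual ℝ E)),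
    ((x'' x' : ℝ) : EReal) ≤ conj f (x', x'')

/-- The multifunction `M f : E ⇉ E*` whose graph is `{(x, x*) : f (x, x*) = ⟨x, x*⟩}`. -/
def M (f : E × StrongDual ℝ E → EReal) : Multi E (StrongDual ℝ E) :=
  fun x => {x' | f (x, x') = ((x' x : ℝ) : EReal)}

/-- A multifunction is strongly representable if it is `M f` for a strongly representative `f`. -/
def IsStronglyRepresentable (S : Multi E (StrongDual ℝ E)) : Prop :=
  ∃ f : E × StrongDual ℝ E → EReal, IsStronglyRepresentative f ∧ M f = S

end Representative

end StrongRep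

end

/-! Both sums come from one construction. For (a), let φ be the lower semicontinuous hull of the
partial inf-convolution (x, x*) ↦ inf over u of f(x, x* - u) + g(x, u); for (b), E and E* exchange
roles. As f and g lie above the pairing, so does φ.

The work lies in the conjugate. The closed-subspace condition makes the constraint π z = π w
regular, so a bound m on the conjugate of φ at p yields a Lagrange multiplier u splitting p into p₁
and p₂ with f*(p₁) + g*(p₂) ≤ m. The pairings at p₁ and p₂ add up to the pairing at p, so φ* lies
above the pairing, with equality only if f* and g* both equal it. The multiplier
(`exists_multiplier`) comes from a Baire and open-mapping argument followed by Hahn–Banach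
separation.

By `IsStronglyRepresentative.mem_M_iff`, coincidence with the pairing can be read off the conjugate
at (x*, x̂), so passing to the hull is harmless: `M φ` is computed from φ* alone. Part (c) follows
from (b), since the range condition puts the bidual summand back in E. -/

noncomputable section

namespace StrongRep

/-! ### Lagrange multipliers from Baire category and Hahn–Banach -/

section Duality

variable {Z Y : Type*} [NormedAddCommGroup Z] [NormedSpace ℝ Z]
  [NormedAddCommGroup Y] [NormedSpace ℝ Y]

/-- If the closure of the image of a bounded closed convex set under a continuous linear map
contains a ball about the origin, then the image itself contains the ball of half the radius. -/
theorem ball_subset_image_of_subset_closure [CompleteSpace Z] {K : Set Z} (hK : Convex ℝ K)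
    (hKc : IsClosed K) {R : ℝ} (hR : ∀ z ∈ K, ‖z‖ ≤ R) (A : Z →L[ℝ] Y) {ε : ℝ}
    (hball : Metric.ball (0 : Y) ε ⊆ closure (A '' K)) :
    Metric.ball (0 : Y) (ε / 2) ⊆ A '' K := by
  intro w hw
  rw [mem_ball_zero_iff] at hw
  have hε : 0 < ε := by have := norm_nonneg w; linarith
  have step : ∀ r : Y, ∃ k : Z, ‖r‖ < ε / 2 → k ∈ K ∧ ‖(2 : ℝ) • r - A k‖ < ε / 2 := by
    intro r
    by_cases hr : ‖r‖ < ε / 2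
    · have h2 : (2 : ℝ) • r ∈ closure (A '' K) := by
        apply hball
        rw [mem_ball_zero_iff, norm_smul]
        norm_num
        linarith
      obtain ⟨_, ⟨k, hk, rfl⟩, hd⟩ := Metric.mem_closure_iff.1 h2 (ε / 2) (by linarith)
      exact ⟨k, fun _ => ⟨hk, by rwa [dist_eq_norm] at hd⟩⟩
    · exact ⟨0, fun h => absurd h hr⟩
  choose κ hκ using step
  -- `r n` is the residual `w - A (s n)` magnified by 2 ^ n; each doubling is compensated by a new
  -- point of `K`.
  let r : ℕ → Y := fun n => Nat.rec w (fun _ y => (2 : ℝ) • y - A (κ y)) n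
  have r_succ : ∀ n, r (n + 1) = (2 : ℝ) • r n - A (κ (r n)) := fun _ => rfl
  have hr : ∀ n, ‖r n‖ < ε / 2 := by
    intro n
    induction n with
    | zero => exact hw
    | succ n ih => rw [r_succ]; exact (hκ _ ih).2
  have hk : ∀ n, κ (r n) ∈ K := fun n => (hκ _ (hr n)).1
  let s : ℕ → Z := fun n => ∑ i ∈ Finset.range n, ((1 / 2 : ℝ) ^ (i + 1)) • κ (r i)
  have s_succ : ∀ n, s (n + 1) = s n + ((1 / 2 : ℝ) ^ (n + 1)) • κ (r n) :=
    fun n => Finset.sum_range_succ _ _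
  -- The weights in `s n` sum to 1 - 2 ^ (-n). Giving the missing weight to any `k ∈ K` completes a
  -- convex combination, so `0 ∈ K` is not needed.
  have hs : ∀ n, ∀ k ∈ K, s n + ((1 / 2 : ℝ) ^ n) • k ∈ K := by
    intro n
    induction n with
    | zero => intro k hk; simpa [s] using hk
    | succ n ih =>
      intro k hk'
      have h := ih _ (hK (hk n) hk' (by norm_num : (0 : ℝ) ≤ 1 / 2)
        (by norm_num : (0 : ℝ) ≤ 1 / 2) (by norm_num))
      convert h using 1
      rw [s_succ, smul_add, smul_smul, smul_smul, ← pow_succ, add_assoc]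
  have hAs : ∀ n, A (s n) = w - ((1 / 2 : ℝ) ^ n) • r n := by
    intro n
    induction n with
    | zero => simp [s, r]
    | succ n ih =>
      rw [s_succ, map_add, ih, map_smul, r_succ, smul_sub, smul_smul]
      have : (1 / 2 : ℝ) ^ (n + 1) * 2 = (1 / 2) ^ n := by rw [pow_succ]; ring
      rw [this]; abel
  have hpow : Filter.Tendsto (fun n : ℕ => (1 / 2 : ℝ) ^ n) Filter.atTop (nhds 0) :=
    tendsto_pow_atTop_nhds_zero_of_lt_one (by norm_num) (by norm_num)
  have hcau : CauchySeq s := by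
    refine cauchySeq_of_le_geometric (1 / 2 : ℝ) (R / 2) (by norm_num) fun n => ?_
    rw [dist_eq_norm, s_succ, norm_sub_rev, add_sub_cancel_left, norm_smul, Real.norm_eq_abs,
      abs_of_pos (by positivity), pow_succ]
    have := hR _ (hk n)
    have hp : (0 : ℝ) < (1 / 2) ^ n := by positivity
    nlinarith
  obtain ⟨z, hz⟩ := cauchySeq_tendsto_of_complete hcau
  refine ⟨z, ?_, ?_⟩
  · have hlim : Filter.Tendsto (fun n => s n + ((1 / 2 : ℝ) ^ n) • κ (r 0)) Filter.atTop
        (nhds (z + (0 : ℝ) • κ (r 0))) := hz.add (hpow.smul_const _)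
    rw [zero_smul, add_zero] at hlim
    exact hKc.mem_of_tendsto hlim (Filter.Eventually.of_forall fun n => hs n _ (hk 0))
  · have h1 : Filter.Tendsto (fun n => A (s n)) Filter.atTop (nhds (A z)) :=
      (A.continuous.tendsto z).comp hz
    have h2 : Filter.Tendsto (fun n => ((1 / 2 : ℝ) ^ n) • r n) Filter.atTop (nhds 0) := by
      refine squeeze_zero_norm (a := fun n => (1 / 2 : ℝ) ^ n * (ε / 2)) (fun n => ?_) ?_
      · rw [norm_smul, Real.norm_eq_abs, abs_of_pos (by positivity)]
        exact mul_le_mul_of_nonneg_left (hr n).le (by positivity)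
      · simpa using hpow.mul_const (ε / 2)
    have h3 : Filter.Tendsto (fun n => A (s n)) Filter.atTop (nhds w) := by
      simp_rw [hAs]
      simpa using (tendsto_const_nhds (x := w)).sub h2
    exact tendsto_nhds_unique h1 h3

/-- If the image of a closed convex set `K` under a continuous linear map between Banach spaces
absorbs every vector, then a bounded part of `K` already covers a ball about the origin. -/
theorem exists_ball_subset_image [CompleteSpace Z] [CompleteSpace Y] {K : Set Z}
    (hK : Convex ℝ K) (hKc : IsClosed K) (A : Z →L[ℝ] Y)
    (habs : ∀ y : Y, ∃ t : ℝ, 0 < t ∧ ∃ z ∈ K, y = t • A z) :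
    ∃ R ε : ℝ, 0 < ε ∧ Metric.ball (0 : Y) ε ⊆ A '' (K ∩ Metric.closedBall 0 R) := by
  -- A point of `K` in the kernel of `A` replaces the origin: mixing with `k₀` shrinks images
  -- towards 0.
  obtain ⟨t₀, ht₀, k₀, hk₀, h₀⟩ := habs 0
  have hAk₀ : A k₀ = 0 := (smul_eq_zero.1 h₀.symm).resolve_left ht₀.ne'
  let C : ℕ → Set Y := fun n => A '' (K ∩ Metric.closedBall 0 n)
  have hCconv : ∀ n, Convex ℝ (C n) := fun n =>
    (hK.inter (convex_closedBall _ _)).linear_image A.toLinearMap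
  have hCmono : ∀ {m n : ℕ}, m ≤ n → C m ⊆ C n := fun h =>
    Set.image_mono (Set.inter_subset_inter_right _
      (Metric.closedBall_subset_closedBall (by exact_mod_cast h)))
  have hcover : ∀ y : Y, ∃ n : ℕ, y ∈ ((n : ℝ) + 1) • C n := by
    intro y
    obtain ⟨t, ht, k, hk, rfl⟩ := habs y
    obtain ⟨n, hn⟩ := exists_nat_ge (max t (max ‖k‖ ‖k₀‖))
    have hn1 : t ≤ n := (le_max_left _ _).trans hn
    have hn2 : ‖k‖ ≤ n := (le_max_left _ _).trans ((le_max_right _ _).trans hn)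
    have hn3 : ‖k₀‖ ≤ n := (le_max_right _ _).trans ((le_max_right _ _).trans hn)
    have hpos : (0 : ℝ) < n + 1 := by positivity
    refine ⟨n, Set.mem_smul_set.2 ⟨(t / (n + 1)) • A k + (1 - t / (n + 1)) • A k₀, ?_, ?_⟩⟩
    · refine hCconv n ⟨k, ⟨hk, by simpa using hn2⟩, rfl⟩ ⟨k₀, ⟨hk₀, by simpa using hn3⟩, rfl⟩
        (by positivity) ?_ (by ring)
      rw [sub_nonneg, div_le_one hpos]
      linarith
    · rw [hAk₀, smul_zero, add_zero, smul_smul, mul_div_cancel₀ _ hpos.ne']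
  obtain ⟨n, c, hc⟩ := nonempty_interior_of_iUnion_of_closed
    (f := fun n : ℕ => ((n : ℝ) + 1) • closure (C n))
    (fun n => isClosed_closure.smul_of_ne_zero (by positivity)) (by
      refine Set.eq_univ_of_forall fun y => ?_
      obtain ⟨n, hn⟩ := hcover y
      exact Set.mem_iUnion.2 ⟨n, Set.smul_set_mono subset_closure hn⟩)
  rw [mem_interior_iff_mem_nhds, Metric.mem_nhds_iff] at hc
  obtain ⟨δ, hδ, hball⟩ := hc
  -- Baire gives a ball about `c`, not 0. A multiple of `C m` containing `-c` recentres it by a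
  -- convex combination with weights proportional to `n + 1` and `m + 1`.
  obtain ⟨m, hm⟩ := hcover (-c)
  obtain ⟨d, hd, hdc⟩ := Set.mem_smul_set.1 hm
  let N := max n m
  have hn' : (0 : ℝ) < n + 1 := by positivity
  have hm' : (0 : ℝ) < m + 1 := by positivity
  have hs : (0 : ℝ) < n + 1 + (m + 1) := by positivity
  have hsub : Metric.ball (0 : Y) (δ / (n + 1 + (m + 1))) ⊆ closure (C N) := by
    intro y hy
    rw [mem_ball_zero_iff, lt_div_iff₀ hs] at hy
    have hy' : c + ((n : ℝ) + 1 + (m + 1)) • y ∈ Metric.ball c δ := by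
      rw [Metric.mem_ball, dist_eq_norm, add_sub_cancel_left, norm_smul, Real.norm_eq_abs,
        abs_of_pos hs, mul_comm]
      exact hy
    obtain ⟨e, he, hec⟩ := Set.mem_smul_set.1 (hball hy')
    have h := (hCconv N).closure (closure_mono (hCmono (le_max_left n m)) he)
      (subset_closure (hCmono (le_max_right n m) hd))
      (div_pos hn' hs).le (div_pos hm' hs).le (by rw [← add_div, div_self hs.ne'])
    convert h using 1
    rw [div_eq_inv_mul, div_eq_inv_mul, mul_smul, mul_smul, ← smul_add, hec, hdc,
      eq_inv_smul_iff₀ hs.ne']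
    abel
  refine ⟨N, _, half_pos (div_pos hδ hs), ball_subset_image_of_subset_closure
    (hK.inter (convex_closedBall _ _)) (hKc.inter Metric.isClosed_closedBall)
    (R := N) (fun z hz => ?_) A hsub⟩
  simpa using hz.2

/-- Lagrange multipliers for minimising a continuous linear functional over a closed convex set
under a linear constraint that is absorbing. -/
theorem exists_multiplier_of_absorbing [CompleteSpace Z] [CompleteSpace Y] {K : Set Z}
    (hK : Convex ℝ K) (hKc : IsClosed K) (A : Z →L[ℝ] Y) (ρ : Z →L[ℝ] ℝ) {m : ℝ}
    (habs : ∀ y : Y, ∃ t : ℝ, 0 < t ∧ ∃ z ∈ K, y = t • A z)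
    (hm : ∀ z ∈ K, A z = 0 → m ≤ ρ z) :
    ∃ u : StrongDual ℝ Y, ∀ z ∈ K, m + u (A z) ≤ ρ z := by
  obtain ⟨R, ε, hε, hball⟩ := exists_ball_subset_image hK hKc A habs
  -- The strict epigraph of the value function of the perturbed problem. Its interior is nonempty
  -- because `ρ` is bounded on the part of `K` covering a ball.
  let S : Set (Y × ℝ) := {p | ∃ z ∈ K, A z = p.1 ∧ ρ z < p.2}
  have hS : Convex ℝ S := by
    rintro ⟨_, t⟩ ⟨z, hz, rfl, hzt⟩ ⟨_, s⟩ ⟨w, hw, rfl, hws⟩ a b ha hb hab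
    refine ⟨a • z + b • w, hK hz hw ha hb hab, by simp, ?_⟩
    simp only [map_add, map_smul, smul_eq_mul, Prod.smul_mk, Prod.mk_add_mk]
    rcases ha.eq_or_lt with rfl | ha
    · have : b = 1 := by linarith
      subst this; simpa using hws
    · nlinarith [mul_lt_mul_of_pos_left hzt ha, mul_le_mul_of_nonneg_left hws.le hb]
  let B : ℝ := ‖ρ‖ * R
  have hsub : Metric.ball (0 : Y) ε ×ˢ Set.Ioi B ⊆ S := by
    rintro ⟨y, t⟩ ⟨hy, ht⟩
    obtain ⟨z, ⟨hz, hzR⟩, rfl⟩ := hball hy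
    refine ⟨z, hz, rfl, lt_of_le_of_lt ?_ ht⟩
    have h1 : ‖z‖ ≤ R := by simpa using hzR
    calc ρ z ≤ ‖ρ z‖ := le_abs_self _
      _ ≤ ‖ρ‖ * ‖z‖ := ρ.le_opNorm z
      _ ≤ ‖ρ‖ * R := by gcongr
  have hint : Metric.ball (0 : Y) ε ×ˢ Set.Ioi B ⊆ interior S :=
    interior_maximal hsub (Metric.isOpen_ball.prod isOpen_Ioi)
  have h0 : ((0 : Y), m) ∉ interior S := by
    intro h
    obtain ⟨z, hz, hAz, hlt⟩ := interior_subset h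
    exact absurd (hm z hz hAz) (not_le.2 hlt)
  obtain ⟨l, hl⟩ := geometric_hahn_banach_open_point hS.interior isOpen_interior h0
  have hlS : ∀ p ∈ S, l p ≤ l (0, m) := by
    intro p hp
    have hne : (interior S).Nonempty :=
      ⟨(0, B + 1), hint ⟨Metric.mem_ball_self hε, by simp⟩⟩
    have hp' : p ∈ closure (interior S) := by
      rw [hS.closure_interior_eq_closure_of_nonempty_interior hne]
      exact subset_closure hp
    exact closure_minimal (t := {p | l p ≤ l (0, m)}) (fun q hq => (hl q hq).le)
      (isClosed_le l.continuous continuous_const) hp'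
  let l₁ : StrongDual ℝ Y := l.comp (ContinuousLinearMap.inl ℝ Y ℝ)
  let α : ℝ := l (0, 1)
  have hdec : ∀ y t, l (y, t) = l₁ y + t * α := by
    intro y t
    have : (y, t) = (y, (0 : ℝ)) + t • ((0 : Y), (1 : ℝ)) := by simp
    rw [this, map_add, map_smul]; rfl
  -- The separating hyperplane is not vertical: a point straight above `(0, m)` is interior to `S`.
  have hα : α < 0 := by
    have h1 := hl (0, max B m + 1) (hint ⟨Metric.mem_ball_self hε, by
      simpa using lt_of_le_of_lt (le_max_left B m) (lt_add_one _)⟩)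
    rw [hdec, hdec] at h1
    have h2 : m < max B m + 1 := lt_of_le_of_lt (le_max_right B m) (lt_add_one _)
    simp only [map_zero, zero_add] at h1
    by_contra h
    nlinarith [mul_le_mul_of_nonneg_right h2.le (not_lt.1 h)]
  refine ⟨(-α)⁻¹ • l₁, fun z hz => ?_⟩
  refine le_of_forall_pos_le_add fun δ hδ => ?_
  have h1 := hlS (A z, ρ z + δ) ⟨z, hz, rfl, by simpa using hδ⟩
  rw [hdec, hdec, map_zero, zero_add] at h1
  have hα' : 0 < -α := by linarith
  have h2 : (-α)⁻¹ * l₁ (A z) ≤ ρ z + δ - m := by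
    rw [inv_mul_le_iff₀ hα']; linarith
  simp only [_root_.smul_apply, smul_eq_mul]
  linarith

/-- Lagrange multipliers for minimising a continuous linear functional over a closed convex set
under a linear constraint whose values generate a closed subspace. -/
theorem exists_multiplier [CompleteSpace Z] [CompleteSpace Y] {K : Set Z}
    (hK : Convex ℝ K) (hKc : IsClosed K) (A : Z →L[ℝ] Y) (ρ : Z →L[ℝ] ℝ) {m : ℝ}
    (L : Submodule ℝ Y) (hL : IsClosed (L : Set Y)) (hKL : ∀ z ∈ K, A z ∈ L)
    (habs : ∀ y ∈ L, ∃ t : ℝ, 0 < t ∧ ∃ z ∈ K, y = t • A z)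
    (hm : ∀ z ∈ K, A z = 0 → m ≤ ρ z) :
    ∃ u : StrongDual ℝ Y, ∀ z ∈ K, m + u (A z) ≤ ρ z := by
  -- Restricting to `L` and its preimage, both complete, makes the constraint absorbing; the
  -- multiplier found on `L` is then extended to `Y`.
  let W : Submodule ℝ Z := L.comap A.toLinearMap
  have hW : IsClosed (W : Set Z) := hL.preimage A.continuous
  have : CompleteSpace L := hL.completeSpace_coe
  have : CompleteSpace W := hW.completeSpace_coe
  let A' : W →L[ℝ] L := (A.comp W.subtypeL).codRestrict L fun w => w.2
  obtain ⟨u, hu⟩ := exists_multiplier_of_absorbing (K := W.subtypeL ⁻¹' K)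
    (hK.linear_preimage W.subtype) (hKc.preimage W.subtypeL.continuous) A' (ρ.comp W.subtypeL)
    (m := m) (by
      rintro ⟨y, hy⟩
      obtain ⟨t, ht, z, hz, rfl⟩ := habs y hy
      exact ⟨t, ht, ⟨z, hKL z hz⟩, hz, rfl⟩)
    (fun z hz h => hm z hz (congrArg Subtype.val h))
  obtain ⟨v, hv, -⟩ := _root_.exists_extension_norm_eq L u
  exact ⟨v, fun z hz => by
    have := hu ⟨z, hKL z hz⟩ hz
    rw [← hv] at this
    exact this⟩

end Duality

/-! ### Convex lower semicontinuous functions and their epigraphs -/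

section Epigraph

variable {X : Type*}

/-- The epigraph of an extended-real function, as a subset of `X × ℝ`. -/
def realEpigraph (h : X → EReal) : Set (X × ℝ) := {p | h p.1 ≤ (p.2 : EReal)}

/-- The extended-real function whose epigraph is generated by the set `G`. -/
def epiFun (G : Set (X × ℝ)) : X → EReal := fun z => ⨅ r : {r : ℝ // (z, r) ∈ G}, (r.1 : EReal)

theorem mem_dom_iff_exists_le [NormedAddCommGroup X] [NormedSpace ℝ X] {h : X → EReal} {z : X} :
    z ∈ dom h ↔ ∃ r : ℝ, h z ≤ r := by
  constructor
  · intro hz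
    obtain ⟨r, hr, -⟩ := EReal.lt_iff_exists_real_btwn.1 (show h z < ⊤ from hz)
    exact ⟨r, hr.le⟩
  · rintro ⟨r, hr⟩
    exact lt_of_le_of_lt hr (EReal.coe_lt_top r)

/-- Closedness of the vertical sections supplies the endpoint: levels just above `r` belong to `G`,
and they decrease to `r`. -/
theorem epiFun_le_coe_iff [TopologicalSpace X] {G : Set (X × ℝ)} (hG : IsClosed G)
    (hup : ∀ z, ∀ r s : ℝ, (z, r) ∈ G → r ≤ s → (z, s) ∈ G) {z : X} {r : ℝ} :
    epiFun G z ≤ r ↔ (z, r) ∈ G := by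
  constructor
  · intro h
    have hcl : IsClosed {s : ℝ | (z, s) ∈ G} := hG.preimage (by fun_prop)
    have hlim : Filter.Tendsto (fun s : ℝ => s) (nhdsWithin r (Set.Ioi r)) (nhds r) :=
      Filter.tendsto_id.mono_left nhdsWithin_le_nhds
    refine hcl.mem_of_tendsto hlim ?_
    filter_upwards [self_mem_nhdsWithin] with s hs
    have h1 : epiFun G z < s := lt_of_le_of_lt h (by exact_mod_cast hs)
    obtain ⟨⟨t, ht⟩, hts⟩ := iInf_lt_iff.1 h1
    exact hup z t s ht (by exact_mod_cast hts.le)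
  · intro h
    exact iInf_le (fun r : {r : ℝ // (z, r) ∈ G} => (r.1 : EReal)) ⟨r, h⟩

theorem coe_le_epiFun {G : Set (X × ℝ)} {b : X → ℝ}
    (hb : ∀ z, ∀ r : ℝ, (z, r) ∈ G → b z ≤ r) (z : X) : (b z : EReal) ≤ epiFun G z :=
  le_iInf fun r => by exact_mod_cast hb z r.1 r.2

variable [NormedAddCommGroup X] [NormedSpace ℝ X]

theorem IsPCLSC.isClosed_realEpigraph {h : X → EReal} (hh : IsPCLSC h) :
    IsClosed (realEpigraph h) := by
  have h1 := hh.lsc.isClosed_epigraph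
  exact h1.preimage (f := fun p : X × ℝ => (p.1, (p.2 : EReal)))
    (continuous_fst.prodMk (continuous_coe_real_ereal.comp continuous_snd))

theorem IsPCLSC.convex_realEpigraph {h : X → EReal} (hh : IsPCLSC h) :
    Convex ℝ (realEpigraph h) := by
  refine convex_iff_forall_pos.2 ?_
  rintro ⟨z, r⟩ hz ⟨w, s⟩ hw a b ha hb hab
  have h1 := hh.convex z w a b ha hb hab
  refine h1.trans ?_
  have h2 : (a : EReal) * h z ≤ (a : EReal) * r :=
    mul_le_mul_of_nonneg_left hz (by exact_mod_cast ha.le)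
  have h3 : (b : EReal) * h w ≤ (b : EReal) * s :=
    mul_le_mul_of_nonneg_left hw (by exact_mod_cast hb.le)
  have h4 := add_le_add h2 h3
  simpa using h4

theorem IsPCLSC.nonempty_realEpigraph {h : X → EReal} (hh : IsPCLSC h) :
    (realEpigraph h).Nonempty := by
  obtain ⟨z, hz⟩ := hh.proper
  obtain ⟨r, hr⟩ := mem_dom_iff_exists_le.1 (lt_top_iff_ne_top.2 hz)
  exact ⟨(z, r), hr⟩

theorem isPCLSC_epiFun {G : Set (X × ℝ)} (hG : IsClosed G) (hconv : Convex ℝ G)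
    (hne : G.Nonempty) (hup : ∀ z, ∀ r s : ℝ, (z, r) ∈ G → r ≤ s → (z, s) ∈ G) {b : X → ℝ}
    (hb : ∀ z, ∀ r : ℝ, (z, r) ∈ G → b z ≤ r) : IsPCLSC (epiFun G) := by
  have hbot : ∀ z, epiFun G z ≠ ⊥ := fun z h => by
    have := coe_le_epiFun hb z
    rw [h, le_bot_iff] at this
    exact EReal.coe_ne_bot _ this
  have hle {z : X} {r : ℝ} : epiFun G z ≤ r ↔ (z, r) ∈ G := epiFun_le_coe_iff hG hup
  refine ⟨hbot, ?_, ?_, ?_⟩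
  · obtain ⟨⟨z, r⟩, hz⟩ := hne
    exact ⟨z, ((hle.2 hz).trans_lt (EReal.coe_lt_top r)).ne⟩
  · intro x y s t hs ht hst
    -- Excluding `⊥` matters because `⊤ + ⊥ = ⊥` in `EReal`.
    have hmul : ∀ c : ℝ, ∀ z, 0 < c → (c : EReal) * epiFun G z ≠ ⊥ := fun c z hc h => by
      by_cases htop : epiFun G z = ⊤
      · rw [htop, EReal.coe_mul_top_of_pos hc] at h; exact absurd h (by simp)
      · rw [← EReal.coe_toReal htop (hbot z), ← EReal.coe_mul] at h
        exact EReal.coe_ne_bot _ h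
    by_cases hx : epiFun G x = ⊤
    · rw [hx, EReal.coe_mul_top_of_pos hs, EReal.top_add_of_ne_bot (hmul t y ht)]
      exact le_top
    by_cases hy : epiFun G y = ⊤
    · rw [hy, EReal.coe_mul_top_of_pos ht, EReal.add_top_of_ne_bot (hmul s x hs)]
      exact le_top
    have hx' := EReal.coe_toReal hx (hbot x)
    have hy' := EReal.coe_toReal hy (hbot y)
    have h1 := hconv (hle.1 hx'.ge) (hle.1 hy'.ge) hs.le ht.le hst
    have h2 := hle.2 h1
    rw [← hx', ← hy']
    simpa using h2
  · rw [lowerSemicontinuous_iff_isClosed_preimage]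
    intro c
    induction c with
    | bot =>
      have : epiFun G ⁻¹' Set.Iic ⊥ = ∅ := by
        ext z; simpa using hbot z
      rw [this]; exact isClosed_empty
    | top => simp
    | coe r =>
      have : epiFun G ⁻¹' Set.Iic (r : EReal) = (fun z => (z, r)) ⁻¹' G := by
        ext z; exact hle
      rw [this]
      exact hG.preimage (by fun_prop)

end Epigraph

/-! ### Fenchel conjugates and biconjugation -/

section Conjugate

variable {X Y : Type*} [NormedAddCommGroup X] [NormedSpace ℝ X]
  [NormedAddCommGroup Y] [NormedSpace ℝ Y]

/-- Testing against real levels `r` above `f z` keeps all later arithmetic in ℝ: an infinite value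
imposes no condition, and a value `⊥` violates every bound. -/
theorem conj_le_coe_iff {f : X × Y → EReal} {p : StrongDual ℝ X × StrongDual ℝ Y} {m : ℝ} :
    conj f p ≤ m ↔ ∀ z : X × Y, ∀ r : ℝ, f z ≤ r → p.1 z.1 + p.2 z.2 - r ≤ m := by
  rw [conj, iSup_le_iff]
  refine forall_congr' fun z => ?_
  induction hz : f z with
  | bot =>
    constructor
    · intro h
      rw [EReal.coe_sub_bot, top_le_iff] at h
      exact absurd h (EReal.coe_ne_top _)
    · intro h
      have := h (p.1 z.1 + p.2 z.2 - m - 1) bot_le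
      linarith
  | top =>
    refine iff_of_true (by simp) fun r hr => ?_
    exact absurd (top_le_iff.1 hr) (EReal.coe_ne_top _)
  | coe s =>
    constructor
    · intro h r hr
      have h1 : p.1 z.1 + p.2 z.2 - s ≤ m := by exact_mod_cast h
      have h2 : s ≤ r := by exact_mod_cast hr
      linarith
    · intro h
      exact_mod_cast h s le_rfl

theorem convex_realEpigraph_conj (f : X × Y → EReal) : Convex ℝ (realEpigraph (conj f)) := by
  rintro ⟨p, m⟩ hp ⟨q, n⟩ hq a b ha hb hab
  refine conj_le_coe_iff.2 fun z r hr => ?_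
  have h1 := mul_le_mul_of_nonneg_left (conj_le_coe_iff.1 hp z r hr) ha
  have h2 := mul_le_mul_of_nonneg_left (conj_le_coe_iff.1 hq z r hr) hb
  simp only [Prod.fst_add, Prod.snd_add, Prod.smul_fst, Prod.smul_snd, _root_.add_apply,
    _root_.smul_apply, smul_eq_mul]
  have h3 : r = a * r + b * r := by rw [← add_mul, hab, one_mul]
  linarith

/-- The Fenchel–Moreau inequality at points of a space in its bidual. -/
theorem le_conj_conj {f : X × Y → EReal} (hf : IsPCLSC f)
    {p₀ : StrongDual ℝ X × StrongDual ℝ Y} {m₀ : ℝ} (h₀ : conj f p₀ ≤ m₀) (z : X × Y) :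
    f z ≤ conj (conj f) (NormedSpace.inclusionInDoubleDual ℝ X z.1,
      NormedSpace.inclusionInDoubleDual ℝ Y z.2) := by
  refine EReal.le_of_forall_lt_iff_le.1 fun m hm => ?_
  by_contra! hlt
  obtain ⟨s, hms, hs⟩ := EReal.lt_iff_exists_real_btwn.1 hlt
  have hm' := conj_le_coe_iff.1 hm.le
  obtain ⟨l, u, hlu, hl⟩ := geometric_hahn_banach_point_closed hf.convex_realEpigraph
    hf.isClosed_realEpigraph (x := (z, s)) (fun h => absurd hs (not_lt.2 h))
  let l₁ : StrongDual ℝ X := l.comp ((ContinuousLinearMap.inl ℝ (X × Y) ℝ).comp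
    (ContinuousLinearMap.inl ℝ X Y))
  let l₂ : StrongDual ℝ Y := l.comp ((ContinuousLinearMap.inl ℝ (X × Y) ℝ).comp
    (ContinuousLinearMap.inr ℝ X Y))
  let α : ℝ := l (0, 1)
  have hdec : ∀ w t, l (w, t) = l₁ w.1 + l₂ w.2 + t * α := by
    rintro ⟨x, y⟩ t
    have : ((x, y), t) = ((x, (0 : Y)), (0 : ℝ)) + (((0 : X), y), (0 : ℝ))
        + t • ((0 : X × Y), (1 : ℝ)) := by simp
    rw [this, map_add, map_add, map_smul]; rfl
  rw [hdec] at hlu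
  have hl' : ∀ w, ∀ t : ℝ, f w ≤ t → u < l₁ w.1 + l₂ w.2 + t * α := fun w t h => by
    rw [← hdec]; exact hl (w, t) h
  -- The epigraph is unbounded upwards, so a negative vertical slope would bring the functional down
  -- to `u`.
  have hα : 0 ≤ α := by
    by_contra! hneg
    obtain ⟨⟨w, t⟩, hw⟩ := hf.nonempty_realEpigraph
    have h1 := hl' w (t + |(l₁ w.1 + l₂ w.2 + t * α - u) / α|)
      (hw.trans (by exact_mod_cast le_add_of_nonneg_right (abs_nonneg _)))
    have h2 := neg_le_abs ((l₁ w.1 + l₂ w.2 + t * α - u) / α)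
    have h3 : (l₁ w.1 + l₂ w.2 + t * α - u) / α * α = l₁ w.1 + l₂ w.2 + t * α - u :=
      div_mul_cancel₀ _ hneg.ne
    nlinarith
  have hms' : m < s := by exact_mod_cast hms
  have h₀' := conj_le_coe_iff.1 h₀
  -- A large multiple of the separating functional is added to the given affine minorant.
  obtain ⟨c, hc0, hc⟩ : ∃ c : ℝ, 0 < c ∧ ∃ d : ℝ, 0 ≤ d ∧ c * α + d = 1 ∧
      s < c * (u - l₁ z.1 - l₂ z.2) + d * (p₀.1 z.1 + p₀.2 z.2 - m₀) := by
    have hδ : 0 < u - l₁ z.1 - l₂ z.2 - s * α := by linarith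
    -- A vertical hyperplane (`α = 0`) gives no minorant alone, so a large multiple tilts the one
    -- given by `p₀`; otherwise dividing by `α` suffices.
    rcases hα.eq_or_lt with h0 | hpos
    · rw [← h0, mul_zero, sub_zero] at hδ
      obtain ⟨c, hc⟩ := exists_gt (max 0 ((s - (p₀.1 z.1 + p₀.2 z.2 - m₀))
        / (u - l₁ z.1 - l₂ z.2)))
      refine ⟨c, (le_max_left _ _).trans_lt hc, 1, zero_le_one, by rw [← h0]; ring, ?_⟩
      have := (le_max_right _ _).trans_lt hc
      rw [div_lt_iff₀ hδ] at this
      linarith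
    · refine ⟨α⁻¹, inv_pos.2 hpos, 0, le_rfl, by rw [inv_mul_cancel₀ hpos.ne', add_zero], ?_⟩
      rw [zero_mul, add_zero, lt_inv_mul_iff₀ hpos]
      linarith
  obtain ⟨d, hd, hcd, hsd⟩ := hc
  have h1 : conj f (d • p₀.1 - c • l₁, d • p₀.2 - c • l₂) ≤ ((d * m₀ - c * u : ℝ) : EReal) := by
    refine conj_le_coe_iff.2 fun w t ht => ?_
    have h2 := mul_le_mul_of_nonneg_left (h₀' w t ht) hd
    have h3 := mul_le_mul_of_nonneg_left (hl' w t ht).le hc0.le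
    simp only [_root_.sub_apply, _root_.smul_apply, smul_eq_mul]
    have h4 : t = c * α * t + d * t := by rw [← add_mul, hcd, one_mul]
    linarith
  have h2 := hm' _ _ h1
  simp only [NormedSpace.dual_def, _root_.sub_apply, _root_.smul_apply, smul_eq_mul] at h2
  linarith

end Conjugate

/-! ### Coincidence with the duality pairing -/

section Pairing

variable {E : Type*} [NormedAddCommGroup E] [NormedSpace ℝ E]

/-- A convex function above the pairing has, at a point where it equals the pairing, a conjugate
which is at most the pairing. -/
theorem conj_le_of_eq_pairing {k : E × StrongDual ℝ E → EReal}
    (hk : Convex ℝ (realEpigraph k)) (hq : ∀ x x', ((x' x : ℝ) : EReal) ≤ k (x, x'))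
    {x : E} {x' : StrongDual ℝ E} (h : k (x, x') = ((x' x : ℝ) : EReal)) :
    conj k (x', NormedSpace.inclusionInDoubleDual ℝ E x) ≤ ((x' x : ℝ) : EReal) := by
  refine conj_le_coe_iff.2 ?_
  rintro ⟨y, y'⟩ r hr
  simp only [NormedSpace.dual_def]
  -- Along the segment to `(y, y')`, convexity bounds `k` by a function affine in `t` while the
  -- pairing is quadratic. They agree at `t = 0`; dividing by `t` and letting `t → 0` compares the
  -- slopes.
  have key : ∀ t : ℝ, 0 < t → t ≤ 1 →
      x' y + y' x - r - x' x ≤ t * (-(y' y - y' x - x' y + x' x)) := by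
    intro t ht ht1
    have h1 : k ((1 - t) • (x, x') + t • (y, y')) ≤ (((1 - t) • x' x + t • r : ℝ) : EReal) :=
      hk (x := ((x, x'), x' x)) (y := ((y, y'), r)) h.le hr (by linarith) ht.le (by ring)
    have h2 := (hq _ _).trans h1
    have h3 := EReal.coe_le_coe_iff.1 h2
    simp only [Prod.smul_fst, Prod.smul_snd, _root_.add_apply, _root_.smul_apply, map_add,
      map_smul, smul_eq_mul] at h3
    have h4 : t * (x' y + y' x - r - x' x) ≤ t * (t * (-(y' y - y' x - x' y + x' x))) := by
      linarith
    exact le_of_mul_le_mul_left h4 ht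
  have hlim : Filter.Tendsto (fun t : ℝ => t * (-(y' y - y' x - x' y + x' x)))
      (nhdsWithin 0 (Set.Ioi 0)) (nhds 0) := by
    have : Filter.Tendsto (fun t : ℝ => t * (-(y' y - y' x - x' y + x' x))) (nhds 0)
        (nhds (0 * (-(y' y - y' x - x' y + x' x)))) := (by fun_prop : Continuous _).tendsto _
    rw [zero_mul] at this
    exact this.mono_left nhdsWithin_le_nhds
  have h5 : x' y + y' x - r - x' x ≤ 0 := by
    refine ge_of_tendsto hlim ?_
    filter_upwards [Ioc_mem_nhdsGT (zero_lt_one' ℝ)] with t ht using key t ht.1 ht.2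
  linarith

/-- The graph of `M k` is also the coincidence set of the conjugate of `k` with the pairing. -/
theorem IsStronglyRepresentative.mem_M_iff {k : E × StrongDual ℝ E → EReal}
    (hk : IsStronglyRepresentative k) {x : E} {x' : StrongDual ℝ E} :
    x' ∈ M k x ↔ NormedSpace.inclusionInDoubleDual ℝ E x ∈ M (conj k) x' := by
  constructor
  · intro h
    refine le_antisymm ?_ (hk.conj_ge_pairing _ _)
    rw [NormedSpace.dual_def]
    exact conj_le_of_eq_pairing hk.representative.pclsc.convex_realEpigraph
      hk.representative.ge_pairing h
  · intro h
    refine le_antisymm ?_ (hk.representative.ge_pairing _ _)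
    -- The same tangency argument one dual higher bounds the biconjugate, which dominates `k` on E ×
    -- E*.
    have h1 := conj_le_of_eq_pairing (convex_realEpigraph_conj k) hk.conj_ge_pairing h
    rw [NormedSpace.dual_def] at h1
    exact (le_conj_conj hk.representative.pclsc h.le (x, x')).trans h1

/-- The lower semicontinuous hull of a convex function above the pairing whose conjugate is above
the pairing is strongly representative. -/
theorem isStronglyRepresentative_epiFun {G : Set ((E × StrongDual ℝ E) × ℝ)}
    (hconv : Convex ℝ G) (hne : G.Nonempty)
    (hup : ∀ z, ∀ r s : ℝ, (z, r) ∈ G → r ≤ s → (z, s) ∈ G)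
    (hq : ∀ z, ∀ r : ℝ, (z, r) ∈ G → z.2 z.1 ≤ r)
    (hq' : ∀ p : StrongDual ℝ E × StrongDual ℝ (StrongDual ℝ E), ∀ m : ℝ,
      (∀ z, ∀ r : ℝ, (z, r) ∈ G → p.1 z.1 + p.2 z.2 - r ≤ m) → p.2 p.1 ≤ m) :
    IsStronglyRepresentative (epiFun (closure G)) ∧
      ∀ (p : StrongDual ℝ E × StrongDual ℝ (StrongDual ℝ E)) (m : ℝ),
        conj (epiFun (closure G)) p ≤ m ↔
          ∀ z, ∀ r : ℝ, (z, r) ∈ G → p.1 z.1 + p.2 z.2 - r ≤ m := by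
  have hup' : ∀ z, ∀ r s : ℝ, (z, r) ∈ closure G → r ≤ s → (z, s) ∈ closure G := by
    intro z r s hz hrs
    have hcont : Continuous fun w : (E × StrongDual ℝ E) × ℝ => (w.1, w.2 + (s - r)) := by
      fun_prop
    have h := map_mem_closure hcont hz (t := G)
      (fun w hw => hup w.1 w.2 _ hw (by linarith))
    simpa using h
  have hq₁ : ∀ z, ∀ r : ℝ, (z, r) ∈ closure G → z.2 z.1 ≤ r := by
    intro z r hz
    have hcl : IsClosed {w : (E × StrongDual ℝ E) × ℝ | w.1.2 w.1.1 ≤ w.2} :=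
      isClosed_le ((continuous_fst.snd).clm_apply continuous_fst.fst) continuous_snd
    exact closure_minimal (fun w hw => hq w.1 w.2 hw) hcl hz
  have hle {z : E × StrongDual ℝ E} {r : ℝ} : epiFun (closure G) z ≤ r ↔ (z, r) ∈ closure G :=
    epiFun_le_coe_iff isClosed_closure hup'
  have hconj : ∀ (p : StrongDual ℝ E × StrongDual ℝ (StrongDual ℝ E)) (m : ℝ),
      conj (epiFun (closure G)) p ≤ m ↔
        ∀ z, ∀ r : ℝ, (z, r) ∈ G → p.1 z.1 + p.2 z.2 - r ≤ m := by
    intro p m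
    rw [conj_le_coe_iff]
    refine ⟨fun h z r hz => h z r (hle.2 (subset_closure hz)), fun h z r hz => ?_⟩
    have hcl : IsClosed {w : (E × StrongDual ℝ E) × ℝ | p.1 w.1.1 + p.2 w.1.2 - w.2 ≤ m} :=
      isClosed_le (by fun_prop) continuous_const
    exact closure_minimal (fun w hw => h w.1 w.2 hw) hcl (hle.1 hz)
  refine ⟨⟨⟨isPCLSC_epiFun isClosed_closure hconv.closure hne.closure hup' hq₁,
    fun x x' => coe_le_epiFun hq₁ (x, x')⟩, fun x' x'' => ?_⟩, hconj⟩
  by_contra! hlt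
  obtain ⟨m, hm, hm'⟩ := EReal.lt_iff_exists_real_btwn.1 hlt
  have h1 := hq' (x', x'') m ((hconj _ _).1 hm.le)
  have h2 : m < x'' x' := by exact_mod_cast hm'
  linarith

/-- An upper bound for the sum of two conjugates gives a bound for the sum of the pairings. When
the sum of the pairings is the bound, both conjugates equal the pairing. -/
theorem conj_eq_pairing_of_add_le {f g : E × StrongDual ℝ E → EReal}
    (hf : IsStronglyRepresentative f) (hg : IsStronglyRepresentative g)
    {p q : StrongDual ℝ E × StrongDual ℝ (StrongDual ℝ E)} {m : ℝ}
    (h : ∀ z, ∀ r : ℝ, f z ≤ r → ∀ w, ∀ s : ℝ, g w ≤ s →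
      (p.1 z.1 + p.2 z.2 - r) + (q.1 w.1 + q.2 w.2 - s) ≤ m) :
    p.2 p.1 + q.2 q.1 ≤ m ∧
      (p.2 p.1 + q.2 q.1 = m → p.2 ∈ M (conj f) p.1 ∧ q.2 ∈ M (conj g) q.1) := by
  -- Taking the supremum over one variable at a time, with the other fixed at a real level, avoids
  -- adding extended reals.
  have h1 : ∀ w, ∀ s : ℝ, g w ≤ s → p.2 p.1 ≤ m - (q.1 w.1 + q.2 w.2 - s) := by
    intro w s hw
    have := (hf.conj_ge_pairing p.1 p.2).trans (conj_le_coe_iff (p := p).2 fun z r hz =>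
      le_sub_iff_add_le.2 (h z r hz w s hw))
    exact_mod_cast this
  have h2 : conj g q ≤ ((m - p.2 p.1 : ℝ) : EReal) :=
    conj_le_coe_iff.2 fun w s hw => by linarith [h1 w s hw]
  have h3 : q.2 q.1 ≤ m - p.2 p.1 := by
    exact_mod_cast (hg.conj_ge_pairing q.1 q.2).trans h2
  refine ⟨by linarith, fun heq => ⟨?_, ?_⟩⟩
  · have h4 : ∀ z, ∀ r : ℝ, f z ≤ r → q.2 q.1 ≤ m - (p.1 z.1 + p.2 z.2 - r) := by
      intro z r hz
      have := (hg.conj_ge_pairing q.1 q.2).trans (conj_le_coe_iff (p := q).2 fun w s hw =>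
        le_sub_iff_add_le'.2 (h z r hz w s hw))
      exact_mod_cast this
    exact le_antisymm (conj_le_coe_iff.2 fun z r hz => by linarith [h4 z r hz])
      (hf.conj_ge_pairing _ _)
  · refine le_antisymm (h2.trans (EReal.coe_le_coe_iff.2 (by linarith)))
      (hg.conj_ge_pairing _ _)

/-- If the multifunction of the conjugate of `g` takes its values in the space, the inverse of the
sum of the conjugate multifunctions restricts to the parallel sum. -/
theorem inverse_add_conj_eq_parallelSum {f g : E × StrongDual ℝ E → EReal}
    (hf : IsStronglyRepresentative f) (hg : IsStronglyRepresentative g)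
    (hrange : Multi.range (M (conj g)) ⊆ Set.range (NormedSpace.inclusionInDoubleDual ℝ E)) :
    (fun x : E => Multi.inverse (M (conj f) + M (conj g))
      (NormedSpace.inclusionInDoubleDual ℝ E x)) = Multi.parallelSum (M f) (M g) := by
  ext x x'
  simp only [Multi.inverse, Multi.parallelSum, Pi.add_apply, Set.mem_add, Set.mem_ofPred_eq,
    Set.mem_inter_iff, hf.mem_M_iff, hg.mem_M_iff, map_sub]
  constructor
  · rintro ⟨a, ha, b, hb, hab⟩
    obtain ⟨v, rfl⟩ := hrange (Set.mem_iUnion.2 ⟨x', hb⟩)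
    exact ⟨v, by rwa [← eq_sub_of_add_eq hab], hb⟩
  · rintro ⟨v, h1, h2⟩
    exact ⟨_, h1, _, h2, sub_add_cancel _ _⟩

end Pairing

/-! ### Constrained inf-convolution and the closed-subspace condition -/

section InfConvolution

variable {E Y : Type*} [NormedAddCommGroup E] [NormedSpace ℝ E] [CompleteSpace E]
  [NormedAddCommGroup Y] [NormedSpace ℝ Y] [CompleteSpace Y]

/-- A general inf-convolution principle. The pairs `(z, w)` with `π z = π w` are combined through a
linear map `B` that adds the pairings. The lower semicontinuous hull of the resulting marginal
function is strongly representative, and its coincidence set is described by multipliers `u`. -/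
theorem exists_isStronglyRepresentative_of_constraint {f g : E × StrongDual ℝ E → EReal}
    (hf : IsStronglyRepresentative f) (hg : IsStronglyRepresentative g)
    (π : E × StrongDual ℝ E →L[ℝ] Y)
    (hcone : IsClosedSubspace (coneDiff (π '' dom g) (π '' dom f)))
    (B : (E × StrongDual ℝ E) × (E × StrongDual ℝ E) →L[ℝ] E × StrongDual ℝ E)
    (hB : ∀ z w, π z = π w → (B (z, w)).2 (B (z, w)).1 = z.2 z.1 + w.2 w.1)
    (p₁ p₂ : StrongDual ℝ E × StrongDual ℝ (StrongDual ℝ E) → StrongDual ℝ Y →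
      StrongDual ℝ E × StrongDual ℝ (StrongDual ℝ E))
    (hp : ∀ p u z w, p.1 (B (z, w)).1 + p.2 (B (z, w)).2 + u (π w - π z) =
      ((p₁ p u).1 z.1 + (p₁ p u).2 z.2) + ((p₂ p u).1 w.1 + (p₂ p u).2 w.2))
    (hpq : ∀ p u, (p₁ p u).2 (p₁ p u).1 + (p₂ p u).2 (p₂ p u).1 = p.2 p.1) :
    ∃ φ : E × StrongDual ℝ E → EReal, IsStronglyRepresentative φ ∧ ∀ x x',
      x' ∈ M φ x ↔ ∃ u,
        (p₁ (x', NormedSpace.inclusionInDoubleDual ℝ E x) u).2 ∈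
          M (conj f) (p₁ (x', NormedSpace.inclusionInDoubleDual ℝ E x) u).1 ∧
        (p₂ (x', NormedSpace.inclusionInDoubleDual ℝ E x) u).2 ∈
          M (conj g) (p₂ (x', NormedSpace.inclusionInDoubleDual ℝ E x) u).1 := by
  obtain ⟨L, hLeq, hLcl⟩ := hcone
  rw [← hLeq] at hLcl
  have hmemL : ∀ y, y ∈ L ↔ ∃ t : ℝ, 0 < t ∧ ∃ w ∈ dom g, ∃ z ∈ dom f, y = t • (π w - π z) := by
    intro y
    rw [← SetLike.mem_coe, hLeq]
    constructor
    · intro hy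
      obtain ⟨t, ht, hy⟩ := Set.mem_iUnion₂.1 hy
      obtain ⟨_, ⟨_, ⟨w, hw, rfl⟩, _, ⟨z, hz, rfl⟩, rfl⟩, rfl⟩ := Set.mem_smul_set.1 hy
      exact ⟨t, ht, w, hw, z, hz, rfl⟩
    · rintro ⟨t, ht, w, hw, z, hz, rfl⟩
      exact Set.mem_iUnion₂.2 ⟨t, ht, Set.smul_mem_smul_set
        (Set.sub_mem_sub (Set.mem_image_of_mem _ hw) (Set.mem_image_of_mem _ hz))⟩
  let Z := ((E × StrongDual ℝ E) × ℝ) × ((E × StrongDual ℝ E) × ℝ)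
  -- Lifting to the product of the epigraphs makes the objective linear and the feasible set closed
  -- and convex.
  let K : Set Z := realEpigraph f ×ˢ realEpigraph g
  have hKconv : Convex ℝ K := hf.representative.pclsc.convex_realEpigraph.prod
    hg.representative.pclsc.convex_realEpigraph
  have hKcl : IsClosed K := hf.representative.pclsc.isClosed_realEpigraph.prod
    hg.representative.pclsc.isClosed_realEpigraph
  let P : Z →L[ℝ] (E × StrongDual ℝ E) × (E × StrongDual ℝ E) :=
    (ContinuousLinearMap.fst ℝ _ _).prodMap (ContinuousLinearMap.fst ℝ _ _)
  let σ : Z →L[ℝ] ℝ := (ContinuousLinearMap.snd ℝ _ _).comp (ContinuousLinearMap.fst ℝ _ _) +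
    (ContinuousLinearMap.snd ℝ _ _).comp (ContinuousLinearMap.snd ℝ _ _)
  let A : Z →L[ℝ] Y := (π.comp (ContinuousLinearMap.snd ℝ _ _) -
    π.comp (ContinuousLinearMap.fst ℝ _ _)).comp P
  have hA : ∀ z r w s, A ((z, r), (w, s)) = π w - π z := fun _ _ _ _ => rfl
  let G : Set ((E × StrongDual ℝ E) × ℝ) :=
    {v | ∃ z r w s, f z ≤ ((r : ℝ) : EReal) ∧ g w ≤ ((s : ℝ) : EReal) ∧ π z = π w ∧
      v = (B (z, w), r + s)}
  have hGconv : Convex ℝ G := by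
    rintro _ ⟨z, r, w, s, hz, hw, hzw, rfl⟩ _ ⟨z', r', w', s', hz', hw', hzw', rfl⟩ a b ha hb hab
    refine ⟨a • z + b • z', a * r + b * r', a • w + b • w', a * s + b * s', ?_, ?_, ?_, ?_⟩
    · exact hf.representative.pclsc.convex_realEpigraph (x := (z, r)) (y := (z', r'))
        hz hz' ha hb hab
    · exact hg.representative.pclsc.convex_realEpigraph (x := (w, s)) (y := (w', s'))
        hw hw' ha hb hab
    · simp only [map_add, map_smul, hzw, hzw']
    · have : (a • z + b • z', a • w + b • w') = a • (z, w) + b • (z', w') := rfl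
      rw [this, map_add, map_smul, map_smul]
      refine Prod.ext rfl ?_
      simp only [Prod.snd_add, Prod.smul_snd, smul_eq_mul]
      ring
  -- A subspace contains 0, so the projected domains meet.
  have hGne : G.Nonempty := by
    obtain ⟨t, ht, w, hw, z, hz, h0⟩ := (hmemL 0).1 L.zero_mem
    obtain ⟨r, hr⟩ := mem_dom_iff_exists_le.1 hz
    obtain ⟨s, hs⟩ := mem_dom_iff_exists_le.1 hw
    have h1 := (smul_eq_zero.1 h0.symm).resolve_left ht.ne'
    exact ⟨_, z, r, w, s, hr, hs, (sub_eq_zero.1 h1).symm, rfl⟩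
  have hGup : ∀ z, ∀ r s : ℝ, (z, r) ∈ G → r ≤ s → (z, s) ∈ G := by
    rintro v a b ⟨z, r, w, s, hz, hw, hzw, hv⟩ hab
    obtain ⟨rfl, rfl⟩ := Prod.mk.inj hv
    refine ⟨z, r + (b - (r + s)), w, s, hz.trans ?_, hw, hzw, by rw [Prod.mk.injEq]; exact
      ⟨rfl, by ring⟩⟩
    exact EReal.coe_le_coe_iff.2 (by linarith)
  have hGq : ∀ z, ∀ r : ℝ, (z, r) ∈ G → z.2 z.1 ≤ r := by
    rintro v a ⟨z, r, w, s, hz, hw, hzw, hv⟩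
    obtain ⟨rfl, rfl⟩ := Prod.mk.inj hv
    rw [hB z w hzw]
    have h1 : z.2 z.1 ≤ r := by exact_mod_cast (hf.representative.ge_pairing z.1 z.2).trans hz
    have h2 : w.2 w.1 ≤ s := by exact_mod_cast (hg.representative.ge_pairing w.1 w.2).trans hw
    linarith
  have hmult : ∀ (p : StrongDual ℝ E × StrongDual ℝ (StrongDual ℝ E)) (m : ℝ),
      (∀ z, ∀ r : ℝ, (z, r) ∈ G → p.1 z.1 + p.2 z.2 - r ≤ m) → ∃ u,
        p.2 p.1 ≤ m ∧ (p.2 p.1 = m → (p₁ p u).2 ∈ M (conj f) (p₁ p u).1 ∧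
          (p₂ p u).2 ∈ M (conj g) (p₂ p u).1) := by
    intro p m h
    -- The bound `h` says that `ρ ≥ -m` on the part of `K` where `A` vanishes; its multiplier `u` is
    -- absorbed into `p₁` and `p₂` by `hp`.
    let ρ : Z →L[ℝ] ℝ := σ - ((p.1.coprod p.2).comp B).comp P
    have hρ : ∀ z r w s, ρ ((z, r), (w, s)) =
        r + s - (p.1 (B (z, w)).1 + p.2 (B (z, w)).2) := fun _ _ _ _ => rfl
    obtain ⟨u, hu⟩ := exists_multiplier hKconv hKcl A ρ (m := -m) L hLcl
      (by
        rintro ⟨⟨z, r⟩, ⟨w, s⟩⟩ ⟨hz, hw⟩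
        exact (hmemL _).2 ⟨1, one_pos, w, mem_dom_iff_exists_le.2 ⟨s, hw⟩, z,
          mem_dom_iff_exists_le.2 ⟨r, hz⟩, by rw [hA, one_smul]⟩)
      (by
        intro y hy
        obtain ⟨t, ht, w, hw, z, hz, rfl⟩ := (hmemL y).1 hy
        obtain ⟨r, hr⟩ := mem_dom_iff_exists_le.1 hz
        obtain ⟨s, hs⟩ := mem_dom_iff_exists_le.1 hw
        exact ⟨t, ht, ((z, r), (w, s)), ⟨hr, hs⟩, rfl⟩)
      (by
        rintro ⟨⟨z, r⟩, ⟨w, s⟩⟩ ⟨hz, hw⟩ h0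
        rw [hA, sub_eq_zero] at h0
        have := h _ _ ⟨z, r, w, s, hz, hw, h0.symm, rfl⟩
        rw [hρ]
        linarith)
    have hsum := conj_eq_pairing_of_add_le hf hg (p := p₁ p u) (q := p₂ p u) (m := m) (by
      intro z r hz w s hw
      have h1 := hu ((z, r), (w, s)) ⟨hz, hw⟩
      rw [hA, hρ] at h1
      have h2 := hp p u z w
      linarith)
    rw [hpq] at hsum
    exact ⟨u, hsum⟩
  obtain ⟨hφ, hφconj⟩ := isStronglyRepresentative_epiFun hGconv hGne hGup hGq
    (fun p m h => (hmult p m h).elim fun _ hu => hu.1)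
  refine ⟨_, hφ, fun x x' => ?_⟩
  rw [hφ.mem_M_iff]
  constructor
  · intro h
    obtain ⟨u, -, hu⟩ := hmult _ _ ((hφconj _ _).1 (le_of_eq h))
    exact ⟨u, hu rfl⟩
  · rintro ⟨u, h1, h2⟩
    -- On pairs satisfying the constraint the multiplier term vanishes, so the two Fenchel
    -- inequalities add up to the required bound.
    refine le_antisymm ((hφconj _ _).2 ?_) (hφ.conj_ge_pairing _ _)
    rintro v a ⟨z, r, w, s, hz, hw, hzw, hv⟩
    obtain ⟨rfl, rfl⟩ := Prod.mk.inj hv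
    have h3 := conj_le_coe_iff.1 (le_of_eq h1) z r hz
    have h4 := conj_le_coe_iff.1 (le_of_eq h2) w s hw
    have h5 := hp (x', NormedSpace.inclusionInDoubleDual ℝ E x) u z w
    have h6 := hpq (x', NormedSpace.inclusionInDoubleDual ℝ E x) u
    rw [hzw, sub_self, map_zero, add_zero] at h5
    dsimp only at h3 h4 h5 h6 ⊢
    linarith

/-- The sum of two strongly representable multifunctions under a constraint qualification on the
projections of the domains to the space. -/
theorem isStronglyRepresentable_add
    {f g : E × StrongDual ℝ E → EReal}
    (hf : IsStronglyRepresentative f) (hg : IsStronglyRepresentative g)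
    (hcone : IsClosedSubspace (coneDiff (Prod.fst '' dom g) (Prod.fst '' dom f))) :
    IsStronglyRepresentable (M f + M g) := by
  obtain ⟨φ, hφ, hM⟩ := exists_isStronglyRepresentative_of_constraint hf hg
    (ContinuousLinearMap.fst ℝ E (StrongDual ℝ E)) hcone
    -- `B` sends `((x, x'), (y, y'))` to `(x, x' + y')`, and the constraint is `x = y`.
    (((ContinuousLinearMap.fst ℝ E (StrongDual ℝ E)).comp (ContinuousLinearMap.fst ℝ _ _)).prod
      ((ContinuousLinearMap.snd ℝ E (StrongDual ℝ E)).coprod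
        (ContinuousLinearMap.snd ℝ E (StrongDual ℝ E))))
    (by
      rintro ⟨x, x'⟩ ⟨y, y'⟩ h
      obtain rfl : x = y := h
      rfl)
    (fun p u => (p.1 - u, p.2)) (fun p u => (u, p.2))
    (by
      rintro ⟨p, q⟩ u ⟨x, x'⟩ ⟨y, y'⟩
      simp
      ring)
    (by
      rintro ⟨p, q⟩ u
      simp)
  refine ⟨φ, hφ, ?_⟩
  ext x x'
  rw [hM]
  simp only [← hf.mem_M_iff, ← hg.mem_M_iff, Pi.add_apply, Set.mem_add]
  constructor
  · rintro ⟨u, h1, h2⟩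
    exact ⟨_, h1, u, h2, sub_add_cancel _ _⟩
  · rintro ⟨a, ha, b, hb, rfl⟩
    exact ⟨b, by rwa [add_sub_cancel_right], hb⟩

/-- The restriction to the space of the inverse of the sum of the conjugate multifunctions, under a
constraint qualification on the projections of the domains to the dual. -/
theorem isStronglyRepresentable_inverse_add_conj
    {f g : E × StrongDual ℝ E → EReal}
    (hf : IsStronglyRepresentative f) (hg : IsStronglyRepresentative g)
    (hcone : IsClosedSubspace (coneDiff (Prod.snd '' dom g) (Prod.snd '' dom f))) :
    IsStronglyRepresentable (fun x : E => Multi.inverse (M (conj f) + M (conj g))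
      (NormedSpace.inclusionInDoubleDual ℝ E x)) := by
  obtain ⟨φ, hφ, hM⟩ := exists_isStronglyRepresentative_of_constraint hf hg
    (ContinuousLinearMap.snd ℝ E (StrongDual ℝ E)) hcone
    -- Now `B` gives `(x + y, x')` under the constraint `x' = y'`, so the multiplier `u` lives in
    -- E** and splits `x̂`.
    (((ContinuousLinearMap.fst ℝ E (StrongDual ℝ E)).coprod
        (ContinuousLinearMap.fst ℝ E (StrongDual ℝ E))).prod
      ((ContinuousLinearMap.snd ℝ E (StrongDual ℝ E)).comp (ContinuousLinearMap.fst ℝ _ _)))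
    (by
      rintro ⟨x, x'⟩ ⟨y, y'⟩ h
      obtain rfl : x' = y' := h
      exact map_add x' x y)
    (fun p u => (p.1, p.2 - u)) (fun p u => (p.1, u))
    (by
      rintro ⟨p, q⟩ u ⟨x, x'⟩ ⟨y, y'⟩
      simp
      ring)
    (by
      rintro ⟨p, q⟩ u
      simp)
  refine ⟨φ, hφ, ?_⟩
  ext x x'
  rw [hM]
  simp only [Multi.inverse, Pi.add_apply, Set.mem_add, Set.mem_ofPred_eq]
  constructor
  · rintro ⟨u, h1, h2⟩
    exact ⟨_, h1, u, h2, sub_add_cancel _ _⟩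
  · rintro ⟨a, ha, b, hb, hab⟩
    exact ⟨b, by rwa [← eq_sub_of_add_eq hab], hb⟩

end InfConvolution

end StrongRep

end

theorem corollary16 {E : Type*} [NormedAddCommGroup E] [NormedSpace ℝ E] [CompleteSpace E]
    [Nontrivial E] (f g : E × StrongDual ℝ E → EReal)
    (hf : StrongRep.IsStronglyRepresentative f) (hg : StrongRep.IsStronglyRepresentative g) :
    (StrongRep.IsClosedSubspace
        (StrongRep.coneDiff (Prod.fst '' StrongRep.dom g) (Prod.fst '' StrongRep.dom f)) →
      StrongRep.IsStronglyRepresentable (StrongRep.M f + StrongRep.M g)) ∧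
    (StrongRep.IsClosedSubspace
        (StrongRep.coneDiff (Prod.snd '' StrongRep.dom g) (Prod.snd '' StrongRep.dom f)) →
      StrongRep.IsStronglyRepresentable (fun x : E =>
        StrongRep.Multi.inverse
          (StrongRep.M (StrongRep.conj f) + StrongRep.M (StrongRep.conj g))
          (NormedSpace.inclusionInDoubleDual ℝ E x))) ∧
    (StrongRep.IsClosedSubspace
        (StrongRep.coneDiff (Prod.snd '' StrongRep.dom g) (Prod.snd '' StrongRep.dom f)) →
      StrongRep.Multi.range (StrongRep.M (StrongRep.conj g)) ⊆
        Set.range (NormedSpace.inclusionInDoubleDual ℝ E) →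
      StrongRep.IsStronglyRepresentable
        (StrongRep.Multi.parallelSum (StrongRep.M f) (StrongRep.M g))) := by
  refine ⟨StrongRep.isStronglyRepresentable_add hf hg,
    StrongRep.isStronglyRepresentable_inverse_add_conj hf hg, fun hcone hrange => ?_⟩
  rw [← StrongRep.inverse_add_conj_eq_parallelSum hf hg hrange]
  exact StrongRep.isStronglyRepresentable_inverse_add_conj hf hg hcone
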